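/- Let $\tau=(x_1,\dots,x_n)$ be a finite (possibly empty) sequence of real numbers, and put $x_0=x_{n+1}=\infty$. The directed horizon visibility graph of $\tau$ is the directed graph with vertices $0,1,\dots,n+1$ in which there is an edge from $i$ to $j$ exactly when $i<j$ and $x_k<x_i$ and $x_k<x_j$ for every $k$ with $i<k<j$. Its in-degree sequence is $(d^{\mathrm{in}}_0,\dots,d^{\mathrm{in}}_{n+1})$ and its out-degree sequence is $(d^{\mathrm{out}}_0,\dots,d^{\mathrm{out}}_{n+1})$, where $d^{\mathrm{in}}_i$ and $d^{\mathrm{out}}_i$ are the numbers of edges ending, respectively starting, at vertex $i$. Theorem. The in-degree and out-degree sequences of a directed horizon visibility graph uniquely determine it: if $\tau=(x_1,\dots,x_n)$ and $\sigma=(y_1,\dots,y_m)$ are finite sequences of real numbers whose directed horizon visibility graphs have the same in-degree sequence and the same out-degree sequence, then $n=m$ and the two graphs have exactly the same edges. -/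

import Mathlib

/-- The directed horizontal visibility graph of a finite series `x = (x 0, …, x (N - 1))` with
values in a linear order: there is an edge from `i` to `j` exactly when `i < j` and every value
strictly between positions `i` and `j` is strictly below both `x i` and `x j`. -/
def directedHVG {α : Type*} [LinearOrder α] {N : ℕ} (x : Fin N → α) : Digraph (Fin N) where
  Adj i j := i < j ∧ ∀ k, i < k → k < j → x k < x i ∧ x k < x j

/-- The series `(∞, x₁, …, xₙ, ∞)` obtained from a real time series `(x₁, …, xₙ)`. -/
def extendByInfinity {n : ℕ} (τ : Fin n → ℝ) : Fin (n + 2) → WithTop ℝ :=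
  Fin.cons ⊤ (Fin.snoc (fun i => (τ i : WithTop ℝ)) ⊤)

/-- The directed horizon visibility graph of a real time series: the directed horizontal
visibility graph of the series extended by `∞` at both ends. -/
noncomputable def directedHorizonVG {n : ℕ} (τ : Fin n → ℝ) : Digraph (Fin (n + 2)) :=
  directedHVG (extendByInfinity τ)

/-- The sequence of in-degrees, in the order of the vertices. -/
noncomputable def inDegreeSeq {N : ℕ} (G : Digraph (Fin N)) : List ℕ :=
  List.ofFn fun v => {u | G.Adj u v}.ncard

/-- The sequence of out-degrees, in the order of the vertices. -/
noncomputable def outDegreeSeq {N : ℕ} (G : Digraph (Fin N)) : List ℕ :=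
  List.ofFn fun v => {w | G.Adj v w}.ncard

/-! Edges of a horizontal visibility graph point forward and do not cross. Suppose two such graphs
have the same degrees and agree on the edges ending before `j`, but not on those ending at `j`. By
equality of in-degrees there are an edge `a → j` of the one graph missing from the other and an edge
`b → j` of the other missing from the one, say with `a < b`. In the graph containing `a → j` no edge
from `b` can jump over `j`, so all edges from `b` end before `j` and belong to the other graph as
well; since the latter also has `b → j`, the out-degrees of `b` differ. -/

/-- A digraph on an ordered vertex set that can be drawn, with its vertices in order on a line, by
arcs above the line that all point forward and do not cross. Arcs may share endpoints. This is the
only property of horizontal visibility graphs needed to recover them from their degrees. -/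
structure IsForwardNoncrossing {V : Type*} [LT V] (G : Digraph V) : Prop where
  lt_of_adj : ∀ {i j}, G.Adj i j → i < j
  not_adj_of_adj : ∀ {i k j l}, i < k → k < j → j < l → G.Adj i j → ¬ G.Adj k l

namespace IsForwardNoncrossing

variable {V : Type*} [LinearOrder V] {G H : Digraph V}

theorem lt_of_adj_of_not_adj (hG : IsForwardNoncrossing G) {a b j w : V} (hab : a < b)
    (hbj : b < j) (haj : G.Adj a j) (hnot : ¬ G.Adj b j) (hbw : G.Adj b w) : w < j := by
  rcases lt_trichotomy w j with hwj | rfl | hjw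
  · exact hwj
  · exact absurd hbw hnot
  · exact absurd hbw (hG.not_adj_of_adj hab hbj hjw haj)

theorem adj_of_encard_le (hG : IsForwardNoncrossing G) {a b j : V} (hab : a < b) (hbj : b < j)
    (haj : G.Adj a j) (hfinOut : {w | G.Adj b w}.Finite)
    (hcard : {w | H.Adj b w}.encard ≤ {w | G.Adj b w}.encard)
    (hsub : ∀ w < j, G.Adj b w → H.Adj b w) (hHbj : H.Adj b j) : G.Adj b j := by
  by_contra hnot
  have hsubset : {w | G.Adj b w} ⊆ {w | H.Adj b w} := fun w hbw =>
    hsub w (hG.lt_of_adj_of_not_adj hab hbj haj hnot hbw) hbw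
  have heq : {w | G.Adj b w} = {w | H.Adj b w} := hfinOut.eq_of_subset_of_encard_le hsubset hcard
  exact hnot (heq.symm.subset hHbj)

theorem adj_iff_of_encard_eq (hG : IsForwardNoncrossing G) (hH : IsForwardNoncrossing H) {j : V}
    (hfinIn : {u | G.Adj u j}.Finite) (hfinOut : ∀ v, {w | G.Adj v w}.Finite)
    (hin : {u | G.Adj u j}.encard = {u | H.Adj u j}.encard)
    (hout : ∀ v, {w | G.Adj v w}.encard = {w | H.Adj v w}.encard)
    (hlt : ∀ k < j, ∀ i, G.Adj i k ↔ H.Adj i k) (i : V) : G.Adj i j ↔ H.Adj i j := by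
  suffices heq : {u | G.Adj u j} = {u | H.Adj u j} from Set.ext_iff.1 heq i
  by_contra hne
  obtain ⟨a, haG, haH⟩ : ∃ a, G.Adj a j ∧ ¬ H.Adj a j := Set.not_subset.1 fun hsub =>
    hne (hfinIn.eq_of_subset_of_encard_le hsub hin.ge)
  obtain ⟨b, hbH, hbG⟩ : ∃ b, H.Adj b j ∧ ¬ G.Adj b j := Set.not_subset.1 fun hsub =>
    hne (hfinIn.eq_of_subset_of_encard_le' hsub hin.le).symm
  rcases lt_trichotomy a b with hab | rfl | hba
  · exact hbG (hG.adj_of_encard_le hab (hH.lt_of_adj hbH) haG (hfinOut b) (hout b).ge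
      (fun w hw => (hlt w hw b).1) hbH)
  · exact hbG haG
  · have hfinOutH : {w | H.Adj a w}.Finite :=
      Set.encard_lt_top_iff.1 (hout a ▸ (hfinOut a).encard_lt_top)
    exact haH (hH.adj_of_encard_le hba (hG.lt_of_adj haG) hbH hfinOutH (hout a).le
      (fun w hw => (hlt w hw a).2) haG)

theorem eq_of_encard_eq [WellFoundedLT V] (hG : IsForwardNoncrossing G)
    (hH : IsForwardNoncrossing H)
    (hfinIn : ∀ v, {u | G.Adj u v}.Finite) (hfinOut : ∀ v, {w | G.Adj v w}.Finite)
    (hin : ∀ v, {u | G.Adj u v}.encard = {u | H.Adj u v}.encard)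
    (hout : ∀ v, {w | G.Adj v w}.encard = {w | H.Adj v w}.encard) : G = H := by
  ext i j
  induction j using WellFoundedLT.induction generalizing i with
  | ind j ih => exact hG.adj_iff_of_encard_eq hH (hfinIn j) hfinOut (hin j) hout ih i

theorem eq_of_degreeSeq_eq {N : ℕ} {G H : Digraph (Fin N)} (hG : IsForwardNoncrossing G)
    (hH : IsForwardNoncrossing H) (hin : inDegreeSeq G = inDegreeSeq H)
    (hout : outDegreeSeq G = outDegreeSeq H) : G = H := by
  have encard_eq {s t : Set (Fin N)} (h : s.ncard = t.ncard) : s.encard = t.encard := by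
    rw [← s.toFinite.cast_ncard_eq, ← t.toFinite.cast_ncard_eq, h]
  exact hG.eq_of_encard_eq hH (fun _ => Set.toFinite _) (fun _ => Set.toFinite _)
    (fun v => encard_eq (congrFun (List.ofFn_injective hin) v))
    (fun v => encard_eq (congrFun (List.ofFn_injective hout) v))

end IsForwardNoncrossing

theorem isForwardNoncrossing_directedHVG {α : Type*} [LinearOrder α] {N : ℕ} (x : Fin N → α) :
    IsForwardNoncrossing (directedHVG x) where
  lt_of_adj hij := hij.1
  not_adj_of_adj hik hkj hjl hij hkl := lt_asymm (hij.2 _ hik hkj).2 (hkl.2 _ hkj hjl).1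

theorem mainTheorem3_general {α β : Type*} [LinearOrder α] [LinearOrder β] {N M : ℕ}
    (x : Fin N → α) (y : Fin M → β)
    (hin : inDegreeSeq (directedHVG x) = inDegreeSeq (directedHVG y))
    (hout : outDegreeSeq (directedHVG x) = outDegreeSeq (directedHVG y)) :
    ∃ h : N = M, ∀ i j : Fin N,
      (directedHVG x).Adj i j ↔ (directedHVG y).Adj (Fin.cast h i) (Fin.cast h j) := by
  obtain rfl : N = M := by simpa [inDegreeSeq] using congrArg List.length hin
  have heq : directedHVG x = directedHVG y :=
    (isForwardNoncrossing_directedHVG x).eq_of_degreeSeq_eq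
      (isForwardNoncrossing_directedHVG y) hin hout
  exact ⟨rfl, fun i j => heq ▸ Iff.rfl⟩

theorem mainTheorem3 {n m : ℕ} (τ : Fin n → ℝ) (σ : Fin m → ℝ)
    (hin : inDegreeSeq (directedHorizonVG τ) = inDegreeSeq (directedHorizonVG σ))
    (hout : outDegreeSeq (directedHorizonVG τ) = outDegreeSeq (directedHorizonVG σ)) :
    ∃ h : n = m, ∀ i j : Fin (n + 2),
      (directedHorizonVG τ).Adj i j ↔
        (directedHorizonVG σ).Adj (Fin.cast (congrArg (· + 2) h) i)
          (Fin.cast (congrArg (· + 2) h) j) := by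
  obtain ⟨h, hadj⟩ := mainTheorem3_general (extendByInfinity τ) (extendByInfinity σ) hin hout
  exact ⟨Nat.add_right_cancel h, hadj⟩
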